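/- Let $\mathcal C$ be a pointed cofibrantly generated model category with homotopy category $H(\mathcal C)$ (the localization of $\mathcal C$ at the weak equivalences), let $Q$ be a cofibrant replacement functor on $\mathcal C$ with natural weak equivalence $Q\to\mathrm{id}$, and let $T\colon\mathcal C\rightleftarrows\mathcal C\colon U$ be a Quillen adjunction with $T$ the left adjoint. Write $\mathbf LT\colon H(\mathcal C)\to H(\mathcal C)$, $X\mapsto T(QX)$, for the left derived functor of $T$. A $T$-spectrum is a sequence $(\mathbf E_n)_{n\ge 0}$ of objects of $\mathcal C$ with assembly morphisms $T(\mathbf E_n)\to \mathbf E_{n+1}$; a morphism of $T$-spectra is a sequence of morphisms in $\mathcal C$ compatible with the assembly morphisms, and the category of $T$-spectra is denoted $Sp^{\mathbb N}(\mathcal C,T)$. A naive $T$-spectrum is a sequence $(E_n)_{n\ge 0}$ of objects of $H(\mathcal C)$ with morphisms $e_n\colon \mathbf LT(E_n)\to E_{n+1}$ in $H(\mathcal C)$; a morphism of naive $T$-spectra is a sequence of morphisms in $H(\mathcal C)$ compatible with the $e_n$. Every $T$-spectrum $\mathbf E$ has an associated naive $T$-spectrum $\mathrm{naive}(\mathbf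 E)$, with the same levels and with assembly morphisms the images in $H(\mathcal C)$ of $T(Q\mathbf E_n)\to T(\mathbf E_n)\to \mathbf E_{n+1}$. Let $H^l(Sp^{\mathbb N}(\mathcal C,T))$ be the localization of $Sp^{\mathbb N}(\mathcal C,T)$ at the levelwise weak equivalences. A $U$-spectrum is a levelwise fibrant $T$-spectrum $W$ whose adjoint assembly morphisms $W_n\to U(W_{n+1})$ are weak equivalences; a morphism $\mathbf A\to \mathbf B$ of $T$-spectra is a stable equivalence if for every $U$-spectrum $W$ it induces a bijection $\mathrm{Hom}_{H^l}(\mathbf B,W)\to \mathrm{Hom}_{H^l}(\mathbf A,W)$. Let $SH(\mathcal C,T)$ be the localization of $Sp^{\mathbb N}(\mathcal C,T)$ at the stable equivalences. Then for every naive $T$-spectrum $(E_n,e_n)_{n\ge 0}$ there is a $T$-spectrum $\mathbf E$ such that 1. $\mathrm{naive}(\mathbf E)\cong (E_n,e_n)_{n\ge 0}$ as naive $T$-spectra; 2. every $T$-spectrum $\mathbf E'$ with $\mathrm{naive}(\mathbf E')\cong (E_n,e_n)_{n\ge 0}$ is isomorphic to $\mathbf E$ in $H^l(Sp^{\mathbb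 N}(\mathcal C,T))$. In particular every naive $T$-spectrum defines a unique object of $SH(\mathcal C,T)$ up to isomorphism: the objects of $SH(\mathcal C,T)$ that are isomorphic to the image of some $T$-spectrum $\mathbf E$ with $\mathrm{naive}(\mathbf E)\cong (E_n,e_n)_{n\ge 0}$ form exactly one isomorphism class. -/

import Mathlib

open CategoryTheory CategoryTheory.Limits HomotopicalAlgebra

universe v u

namespace NaiveSpectra

/-- A model category is cofibrantly generated if there are sets of morphisms `I` and `J`, both
permitting the small object argument, such that the fibrations are the morphisms with the right
lifting property with respect to `J` and the trivial fibrations are those with the right lifting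
property with respect to `I`. (Smallness of the sets `I`, `J` is part of
`HasSmallObjectArgument`.) -/
class IsCofibrantlyGenerated (C : Type u) [Category.{v} C] [ModelCategory C] : Prop where
  exists_generators : ∃ I J : MorphismProperty C,
    MorphismProperty.HasSmallObjectArgument.{v} I ∧
    MorphismProperty.HasSmallObjectArgument.{v} J ∧
    trivialFibrations C = I.rlp ∧ fibrations C = J.rlp

/-- An adjunction between model categories is a Quillen adjunction if the left adjoint preserves
cofibrations and trivial cofibrations. -/
class IsQuillenAdjunction {C : Type u} [Category.{v} C] [ModelCategory C] {T U : C ⥤ C}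
    (adj : T ⊣ U) : Prop where
  cofibration_map {X Y : C} (i : X ⟶ Y) [Cofibration i] : Cofibration (T.map i)
  weakEquivalence_map {X Y : C} (i : X ⟶ Y) [Cofibration i] [WeakEquivalence i] :
    WeakEquivalence (T.map i)

/-- A cofibrant replacement functor `Q` with its natural weak equivalence `Q ⟶ 𝟭 C`. -/
structure CofibrantReplacement (C : Type u) [Category.{v} C] [ModelCategory C] where
  /-- the functor -/
  functor : C ⥤ C
  /-- the augmentation -/
  counit : functor ⟶ 𝟭 C
  isCofibrant (X : C) : IsCofibrant (functor.obj X)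
  weakEquivalence (X : C) : WeakEquivalence (counit.app X)

section Spectra

/-- A spectrum with respect to an endofunctor `F`: a sequence of objects with assembly morphisms
`F (E n) ⟶ E (n + 1)`. -/
structure Spectrum {D : Type u} [Category.{v} D] (F : D ⥤ D) where
  /-- the levels -/
  obj : ℕ → D
  /-- the assembly morphisms -/
  assembly (n : ℕ) : F.obj (obj n) ⟶ obj (n + 1)

namespace Spectrum

variable {D : Type u} [Category.{v} D] {F : D ⥤ D}

/-- Morphisms of spectra: levelwise morphisms compatible with the assembly morphisms. -/
@[ext]
structure Hom (E E' : Spectrum F) where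
  /-- the levels -/
  hom (n : ℕ) : E.obj n ⟶ E'.obj n
  comm (n : ℕ) : E.assembly n ≫ hom (n + 1) = F.map (hom n) ≫ E'.assembly n

instance : Category (Spectrum F) where
  Hom E E' := Hom E E'
  id E := { hom := fun n => 𝟙 (E.obj n), comm := fun n => by simp }
  comp f g :=
    { hom := fun n => f.hom n ≫ g.hom n
      comm := fun n => by
        rw [← Category.assoc, f.comm, Category.assoc, g.comm, F.map_comp, Category.assoc] }
  id_comp f := Hom.ext (funext fun n => Category.id_comp (f.hom n))
  comp_id f := Hom.ext (funext fun n => Category.comp_id (f.hom n))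
  assoc f g h := Hom.ext (funext fun n => Category.assoc (f.hom n) (g.hom n) (h.hom n))

@[ext]
lemma hom_ext {E E' : Spectrum F} {f g : E ⟶ E'} (h : ∀ n, f.hom n = g.hom n) : f = g :=
  Hom.ext (funext h)

@[simp]
lemma id_hom (E : Spectrum F) (n : ℕ) : Hom.hom (𝟙 E) n = 𝟙 (E.obj n) := rfl

@[simp]
lemma comp_hom {E E' E'' : Spectrum F} (f : E ⟶ E') (g : E' ⟶ E'') (n : ℕ) :
    (f ≫ g).hom n = f.hom n ≫ g.hom n := rfl

end Spectrum

end Spectra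

variable {C : Type u} [Category.{v} C] [ModelCategory C]

/-- The homotopy category `H(C)`: the localization of `C` at the weak equivalences. -/
abbrev Ho (C : Type u) [Category.{v} C] [ModelCategory C] := (weakEquivalences C).Localization

/-- The localization functor `C ⥤ H(C)`. -/
abbrev toHo (C : Type u) [Category.{v} C] [ModelCategory C] : C ⥤ Ho C := (weakEquivalences C).Q

/-- Ken Brown's lemma for left Quillen functors. -/
lemma weakEquivalence_map_of_isCofibrant {T U : C ⥤ C} (adj : T ⊣ U) [IsQuillenAdjunction adj]
    {X Y : C} (f : X ⟶ Y) [IsCofibrant X] [IsCofibrant Y] [WeakEquivalence f] :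
    WeakEquivalence (T.map f) := by
  have h : CofibrantBrownFactorization f := Classical.arbitrary _
  have hi : WeakEquivalence (T.map h.i) := IsQuillenAdjunction.weakEquivalence_map adj h.i
  have hs : WeakEquivalence (T.map h.s) := IsQuillenAdjunction.weakEquivalence_map adj h.s
  have hsp : T.map h.s ≫ T.map h.p = 𝟙 _ := by rw [← T.map_comp, h.s_p, T.map_id]
  have hp : WeakEquivalence (T.map h.p) := weakEquivalence_of_precomp_of_fac hsp
  rw [← h.fac, T.map_comp]
  infer_instance

/-- The functor `X ↦ T (Q X)` sends weak equivalences to isomorphisms in `H(C)`. -/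
lemma isInvertedBy_comp {T U : C ⥤ C} (adj : T ⊣ U) [IsQuillenAdjunction adj]
    (Q : CofibrantReplacement C) :
    (weakEquivalences C).IsInvertedBy (Q.functor ⋙ T ⋙ toHo C) := by
  intro X Y f hf
  have hf' : WeakEquivalence f := ⟨hf⟩
  have hX := Q.isCofibrant X
  have hY := Q.isCofibrant Y
  let qX : Q.functor.obj X ⟶ X := Q.counit.app X
  let qY : Q.functor.obj Y ⟶ Y := Q.counit.app Y
  have hqX : WeakEquivalence qX := Q.weakEquivalence X
  have hqY : WeakEquivalence qY := Q.weakEquivalence Y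
  have hn : Q.functor.map f ≫ qY = qX ≫ f := Q.counit.naturality f
  have hQ : WeakEquivalence (Q.functor.map f) := weakEquivalence_of_postcomp_of_fac hn
  have hT : WeakEquivalence (T.map (Q.functor.map f)) := weakEquivalence_map_of_isCofibrant adj _
  exact Localization.inverts (toHo C) (weakEquivalences C) _ hT.mem

section Naive

variable {T U : C ⥤ C} (adj : T ⊣ U) [IsQuillenAdjunction adj] (Q : CofibrantReplacement C)

/-- The total left derived functor `LT : H(C) ⥤ H(C)`, given on objects of `C` by
`X ↦ T (Q X)`. -/
noncomputable def leftDerived : Ho C ⥤ Ho C :=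
  Localization.lift (Q.functor ⋙ T ⋙ toHo C) (isInvertedBy_comp adj Q) (toHo C)

/-- The identification of `LT (X)` with `T (Q X)` in `H(C)`, for `X` in `C`. -/
noncomputable def leftDerivedIso :
    toHo C ⋙ leftDerived adj Q ≅ Q.functor ⋙ T ⋙ toHo C :=
  Localization.fac (Q.functor ⋙ T ⋙ toHo C) (isInvertedBy_comp adj Q) (toHo C)

/-- Naive `T`-spectra: sequences of objects of `H(C)` with assembly morphisms
`LT (E n) ⟶ E (n + 1)` in `H(C)`; the morphisms are the levelwise morphisms in `H(C)` that are
compatible with the assembly morphisms. -/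
abbrev NaiveSpectrum := Spectrum (leftDerived adj Q)

/-- The functor from `T`-spectra to naive `T`-spectra. The assembly morphisms of the image of `E`
are the images in `H(C)` of `T (Q (E n)) ⟶ T (E n) ⟶ E (n + 1)`. -/
noncomputable def naive : Spectrum T ⥤ NaiveSpectrum adj Q where
  obj E :=
    { obj := fun n => (toHo C).obj (E.obj n)
      assembly := fun n => (leftDerivedIso adj Q).hom.app (E.obj n) ≫
        (toHo C).map (T.map (Q.counit.app (E.obj n)) ≫ E.assembly n) }
  map {E E'} f :=
    { hom := fun n => (toHo C).map (f.hom n)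
      comm := fun n => by
        have h := (leftDerivedIso adj Q).hom.naturality (f.hom n)
        have hq := Q.counit.naturality (f.hom n)
        dsimp at h hq
        rw [reassoc_of% h, Category.assoc, ← (toHo C).map_comp, ← (toHo C).map_comp,
          Category.assoc, f.comm, ← T.map_comp_assoc, ← T.map_comp_assoc, hq] }
  map_id E := by ext n; simp
  map_comp f g := by ext n; simp

end Naive

/-- Levelwise weak equivalences of `T`-spectra. -/
def levelEquivalences (T : C ⥤ C) : MorphismProperty (Spectrum T) :=
  fun _ _ f => ∀ n, WeakEquivalence (f.hom n)

/-- The homotopy category of `T`-spectra for the levelwise model structure. -/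
abbrev LevelHo (T : C ⥤ C) := (levelEquivalences T).Localization

/-- The localization functor from `T`-spectra to the levelwise homotopy category. -/
abbrev toLevelHo (T : C ⥤ C) : Spectrum T ⥤ LevelHo T := (levelEquivalences T).Q

section Stable

variable {T U : C ⥤ C} (adj : T ⊣ U)

/-- A `U`-spectrum (the analogue of an `Ω`-spectrum): a levelwise fibrant `T`-spectrum `W` such
that the adjoints `W n ⟶ U (W (n + 1))` of the assembly morphisms are weak equivalences. -/
structure IsUSpectrum (W : Spectrum T) : Prop where
  isFibrant (n : ℕ) : IsFibrant (W.obj n)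
  weakEquivalence (n : ℕ) :
    WeakEquivalence (adj.homEquiv (W.obj n) (W.obj (n + 1)) (W.assembly n))

/-- Stable equivalences: the morphisms `f : A ⟶ B` of `T`-spectra that induce, for every
`U`-spectrum `W`, a bijection from morphisms `B ⟶ W` to morphisms `A ⟶ W` in the levelwise
homotopy category. -/
def stableEquivalences : MorphismProperty (Spectrum T) :=
  fun _ B f => ∀ W : Spectrum T, IsUSpectrum adj W →
    Function.Bijective (fun g : (toLevelHo T).obj B ⟶ (toLevelHo T).obj W =>
      (toLevelHo T).map f ≫ g)

/-- The stable homotopy category `SH(C, T)`. -/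
abbrev SH := (stableEquivalences adj).Localization

/-- The localization functor from `T`-spectra to the stable homotopy category. -/
abbrev toSH : Spectrum T ⥤ SH adj := (stableEquivalences adj).Q

end Stable

end NaiveSpectra

/-! Existence: realise the levels by bifibrant objects. Since `T` preserves cofibrant objects, each
assembly morphism in H(C) is represented by an actual morphism (`exists_bifibrant_naive_iso`).
Uniqueness: a spectrum imposes a single square per level and no higher coherences. If the assembly
morphisms of the source are cofibrations and the target is levelwise fibrant, a square commuting in
H(C) can be made strictly commutative by homotopy extension, level by level (`exists_extension`,
`exists_naive_map_eq`). An isomorphism of naive spectra thus lifts to a levelwise equivalence from a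
resolution of E' to E. The lift involves choices, so the resulting isomorphism is not canonical. -/

namespace NaiveSpectra

open MorphismProperty

namespace Spectrum

variable {D : Type u} [Category.{v} D] {F : D ⥤ D}

/-- Constructor for isomorphisms of spectra. -/
def isoMk {E E' : Spectrum F} (e : ∀ n, E.obj n ≅ E'.obj n)
    (comm : ∀ n, E.assembly n ≫ (e (n + 1)).hom = F.map (e n).hom ≫ E'.assembly n) : E ≅ E' where
  hom := { hom := fun n => (e n).hom, comm := comm }
  inv :=
    { hom := fun n => (e n).inv
      comm := fun n => by
        rw [Iso.comp_inv_eq, Category.assoc, comm, ← F.map_comp_assoc, Iso.inv_hom_id, F.map_id,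
          Category.id_comp] }
  hom_inv_id := hom_ext fun n => (e n).hom_inv_id
  inv_hom_id := hom_ext fun n => (e n).inv_hom_id

/-- The levels of an isomorphism of spectra. -/
def levelIso {E E' : Spectrum F} (e : E ≅ E') (n : ℕ) : E.obj n ≅ E'.obj n where
  hom := e.hom.hom n
  inv := e.inv.hom n
  hom_inv_id := by rw [← comp_hom, e.hom_inv_id, id_hom]
  inv_hom_id := by rw [← comp_hom, e.inv_hom_id, id_hom]

end Spectrum

/-! ### Homotopy lifting and extension in a model category -/

section ModelCategory

variable {C : Type u} [Category.{v} C] [ModelCategory C]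

/-- A weak equivalence of `C` becomes an isomorphism in `H(C)`. -/
lemma isIso_toHo_map {X Y : C} (f : X ⟶ Y) [hf : WeakEquivalence f] : IsIso ((toHo C).map f) :=
  Localization.inverts (toHo C) (weakEquivalences C) f hf.mem

/-- A fibration between bifibrant objects which becomes invertible in `H(C)` is a weak
equivalence. -/
lemma weakEquivalence_of_fibration_of_isIso_toHo_map {X Y : C} (p : X ⟶ Y) [Fibration p]
    [IsCofibrant X] [IsCofibrant Y] [IsFibrant Y] [IsIso ((toHo C).map p)] :
    WeakEquivalence p := by
  have : IsFibrant X := isFibrant_of_fibration p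
  obtain ⟨s, hs⟩ := map_surjective_of_isLocalization (toHo C) Y X (inv ((toHo C).map p))
  have hsp : LeftHomotopyRel (s ≫ p) (𝟙 Y) := by
    rw [LeftHomotopyRel.iff_map_eq (toHo C)]
    simp [hs]
  obtain ⟨P, _, ⟨h⟩⟩ := hsp.exists_good_cylinder
  -- The homotopy from `s ≫ p` to the identity lifts along the fibration `p`, deforming `s` into a
  -- strict section `t`.
  obtain ⟨t, h', hh'⟩ := h.covering_homotopy p s
  have htp : t ≫ p = 𝟙 Y := by rw [← h'.h₁, Category.assoc, hh', h.h₁]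
  have hpt : LeftHomotopyRel (𝟙 X) (p ≫ t) := by
    rw [LeftHomotopyRel.iff_map_eq (toHo C), (toHo C).map_comp,
      ← (LeftHomotopyRel.iff_map_eq (toHo C) _ _).1 h'.leftHomotopyRel, hs]
    simp
  obtain ⟨P', ⟨h''⟩⟩ := hpt
  have hw : WeakEquivalence (p ≫ t) := (h''.weakEquivalence_iff P').1 inferInstance
  -- As `t` is a strict section, `p` is a retract of `p ≫ t`, which is homotopic to the identity.
  have r : RetractArrow p (p ≫ t) :=
    { i := Arrow.homMk (𝟙 X) t
      r := Arrow.homMk (𝟙 X) p (by simp [htp])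
      retract := by ext <;> simp [htp] }
  exact ⟨of_retract r hw.mem⟩

/-- A morphism from a cofibrant object to a bifibrant object which becomes invertible in `H(C)` is
a weak equivalence. -/
lemma weakEquivalence_of_isIso_toHo_map {X Y : C} (f : X ⟶ Y) [IsCofibrant X] [IsCofibrant Y]
    [IsFibrant Y] [IsIso ((toHo C).map f)] : WeakEquivalence f := by
  let d := factorizationData (trivialCofibrations C) (fibrations C) f
  have : IsCofibrant d.Z := isCofibrant_of_cofibration d.i
  have := isIso_toHo_map d.i
  have hfac : (toHo C).map d.i ≫ (toHo C).map d.p = (toHo C).map f := by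
    rw [← (toHo C).map_comp, d.fac]
  have : IsIso ((toHo C).map d.p) := IsIso.of_isIso_fac_left hfac
  have := weakEquivalence_of_fibration_of_isIso_toHo_map d.p
  rw [← d.fac]
  infer_instance

/-- Extension along a cofibration of a morphism to a fibrant object, when it extends in `H(C)`;
the class of the extension in `H(C)` can be prescribed. -/
lemma exists_extension {A X B : C} (i : A ⟶ X) [Cofibration i] [IsCofibrant A] [IsFibrant B]
    (f : A ⟶ B) (φ : (toHo C).obj X ⟶ (toHo C).obj B)
    (h : (toHo C).map i ≫ φ = (toHo C).map f) :
    ∃ g : X ⟶ B, i ≫ g = f ∧ (toHo C).map g = φ := by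
  have : IsCofibrant X := isCofibrant_of_cofibration i
  obtain ⟨l, rfl⟩ := map_surjective_of_isLocalization (toHo C) X B φ
  have hl : RightHomotopyRel (i ≫ l) f := by
    rw [RightHomotopyRel.iff_map_eq (toHo C), (toHo C).map_comp, h]
  obtain ⟨P, _, ⟨H⟩⟩ := hl.exists_good_pathObject
  -- The homotopy from `i ≫ l` to `f` extends over `X`, starting at `l`; its other end is a strict
  -- extension of `f` in the class of `l`.
  obtain ⟨g, H', hH'⟩ := H.homotopy_extension i l
  refine ⟨g, by rw [← H'.h₁, ← Category.assoc, hH', H.h₁], ?_⟩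
  exact ((RightHomotopyRel.iff_map_eq (toHo C) _ _).1 H'.rightHomotopyRel).symm

/-- Every object of `H(C)` is isomorphic to the image of a bifibrant object. -/
lemma exists_bifibrant_iso (X : Ho C) :
    ∃ (Y : C) (_ : IsCofibrant Y) (_ : IsFibrant Y), Nonempty ((toHo C).obj Y ≅ X) := by
  have := Localization.essSurj (BifibrantObject.ι ⋙ toHo C)
    (weakEquivalences (BifibrantObject C))
  let Y := (BifibrantObject.ι ⋙ toHo C).objPreimage X
  exact ⟨Y.obj, inferInstance, inferInstance,
    ⟨(BifibrantObject.ι ⋙ toHo C).objObjPreimageIso X⟩⟩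

/-- Left Quillen functors preserve cofibrant objects. -/
lemma isCofibrant_obj {T U : C ⥤ C} (adj : T ⊣ U) [IsQuillenAdjunction adj] (X : C)
    [IsCofibrant X] : IsCofibrant (T.obj X) := by
  have : PreservesColimitsOfSize.{0, 0} T := adj.leftAdjoint_preservesColimits
  rw [isCofibrant_iff_of_isInitial (T.map (initial.to X))
    (IsInitial.isInitialObj T _ initialIsInitial)]
  exact IsQuillenAdjunction.cofibration_map adj _

/-- If `X` is cofibrant, then `T (Q X) ⟶ T X` is invertible in `H(C)`. -/
lemma isIso_toHo_map_counit {T U : C ⥤ C} (adj : T ⊣ U) [IsQuillenAdjunction adj]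
    (Q : CofibrantReplacement C) (X : C) [IsCofibrant X] :
    IsIso ((toHo C).map (T.map (Q.counit.app X))) := by
  have hQ := Q.isCofibrant X
  let q : Q.functor.obj X ⟶ X := Q.counit.app X
  have : WeakEquivalence q := Q.weakEquivalence X
  have := weakEquivalence_map_of_isCofibrant adj q
  exact isIso_toHo_map (T.map q)

end ModelCategory

/-! ### Cofibrant resolution of spectra -/

section Resolution

variable {C : Type u} [Category.{v} C] [ModelCategory C] {T : C ⥤ C} (E : Spectrum T)

/-- The levels, with their augmentations, of the cofibrant resolution of a spectrum for the
levelwise model structure. -/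
noncomputable def resolutionLevel : (n : ℕ) → (X : C) × (X ⟶ E.obj n)
  | 0 =>
    let d := factorizationData (cofibrations C) (trivialFibrations C) (initial.to (E.obj 0))
    ⟨d.Z, d.p⟩
  | n + 1 =>
    let d := factorizationData (cofibrations C) (trivialFibrations C)
      (T.map (resolutionLevel n).2 ≫ E.assembly n)
    ⟨d.Z, d.p⟩

/-- A cofibrant resolution of a spectrum for the levelwise model structure. -/
noncomputable def resolution : Spectrum T where
  obj n := (resolutionLevel E n).1
  assembly n := (factorizationData (cofibrations C) (trivialFibrations C)
    (T.map (resolutionLevel E n).2 ≫ E.assembly n)).i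

/-- The augmentation of the cofibrant resolution of a spectrum. -/
noncomputable def resolutionHom : resolution E ⟶ E where
  hom n := (resolutionLevel E n).2
  comm n := (factorizationData (cofibrations C) (trivialFibrations C)
    (T.map (resolutionLevel E n).2 ≫ E.assembly n)).fac

lemma levelEquivalences_resolutionHom : levelEquivalences T (resolutionHom E) := by
  intro n
  cases n with
  | zero =>
    exact inferInstanceAs (WeakEquivalence (factorizationData (cofibrations C)
      (trivialFibrations C) (initial.to (E.obj 0))).p)
  | succ n =>
    exact inferInstanceAs (WeakEquivalence (factorizationData (cofibrations C)
      (trivialFibrations C) (T.map (resolutionLevel E n).2 ≫ E.assembly n)).p)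

lemma cofibration_resolution_assembly (n : ℕ) : Cofibration ((resolution E).assembly n) :=
  inferInstanceAs (Cofibration (factorizationData (cofibrations C)
    (trivialFibrations C) (T.map (resolutionLevel E n).2 ≫ E.assembly n)).i)

lemma isCofibrant_resolution_obj {U : C ⥤ C} (adj : T ⊣ U) [IsQuillenAdjunction adj] (n : ℕ) :
    IsCofibrant ((resolution E).obj n) := by
  induction n with
  | zero =>
    let d := factorizationData (cofibrations C) (trivialFibrations C) (initial.to (E.obj 0))
    exact (isCofibrant_iff_of_isInitial d.i initialIsInitial).2 inferInstance
  | succ n hn =>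
    have := isCofibrant_obj adj ((resolution E).obj n)
    have := cofibration_resolution_assembly E n
    exact isCofibrant_of_cofibration ((resolution E).assembly n)

end Resolution

/-! ### Lifting naive objects and morphisms -/

section Lifting

variable {C : Type u} [Category.{v} C] [ModelCategory C] {T U : C ⥤ C} (adj : T ⊣ U)
  [IsQuillenAdjunction adj] (Q : CofibrantReplacement C)

/-- The compatibility with assembly morphisms of a pair of consecutive levels of a morphism of
naive spectra, the first of which comes from `C`, can be checked on `T (A n)` instead of
`T (Q (A n))` if `A n` is cofibrant. -/
lemma map_assembly_comp_eq {A B : Spectrum T} (n : ℕ) [IsCofibrant (A.obj n)]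
    (f : A.obj n ⟶ B.obj n) (φ : (toHo C).obj (A.obj (n + 1)) ⟶ (toHo C).obj (B.obj (n + 1)))
    (h : ((naive adj Q).obj A).assembly n ≫ φ =
      (leftDerived adj Q).map ((toHo C).map f) ≫ ((naive adj Q).obj B).assembly n) :
    (toHo C).map (A.assembly n) ≫ φ = (toHo C).map (T.map f ≫ B.assembly n) := by
  have := isIso_toHo_map_counit adj Q (A.obj n)
  have hn := (leftDerivedIso adj Q).hom.naturality f
  have hq := Q.counit.naturality f
  dsimp [naive] at h hn hq
  rw [reassoc_of% hn, Category.assoc, cancel_epi, ← Functor.map_comp, ← T.map_comp_assoc, hq,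
    T.map_comp_assoc, Functor.map_comp, Functor.map_comp, Category.assoc, cancel_epi] at h
  exact h

/-- A morphism of naive spectra `naive A ⟶ naive B` comes from a morphism of spectra, if `A` is
cofibrant for the levelwise model structure and `B` is levelwise fibrant. -/
lemma exists_naive_map_eq {A B : Spectrum T} (hA₀ : IsCofibrant (A.obj 0))
    (hA : ∀ n, Cofibration (A.assembly n)) (hB : ∀ n, IsFibrant (B.obj n))
    (φ : (naive adj Q).obj A ⟶ (naive adj Q).obj B) :
    ∃ f : A ⟶ B, (naive adj Q).map f = φ := by
  have hA' (n : ℕ) : IsCofibrant (A.obj n) := by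
    induction n with
    | zero => exact hA₀
    | succ n hn =>
      have := isCofibrant_obj adj (A.obj n)
      exact isCofibrant_of_cofibration (A.assembly n)
  have step (n : ℕ) (f : { f : A.obj n ⟶ B.obj n // (toHo C).map f = φ.hom n }) :
      ∃ g : A.obj (n + 1) ⟶ B.obj (n + 1),
        A.assembly n ≫ g = T.map f.1 ≫ B.assembly n ∧ (toHo C).map g = φ.hom (n + 1) := by
    have := isCofibrant_obj adj (A.obj n)
    exact exists_extension (A.assembly n) (T.map f.1 ≫ B.assembly n) (φ.hom (n + 1))
      (map_assembly_comp_eq adj Q n f.1 _ (by rw [f.2]; exact φ.comm n))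
  choose g hg hg' using step
  obtain ⟨f₀, hf₀⟩ := map_surjective_of_isLocalization (toHo C) (A.obj 0) (B.obj 0) (φ.hom 0)
  -- Carrying the class in H(C) along the recursion is what makes the next square commute up to
  -- homotopy.
  let f (n : ℕ) : { f : A.obj n ⟶ B.obj n // (toHo C).map f = φ.hom n } :=
    Nat.rec ⟨f₀, hf₀⟩ (fun n f => ⟨g n f, hg' n f⟩) n
  exact ⟨{ hom := fun n => (f n).1, comm := fun n => hg n (f n) },
    Spectrum.hom_ext fun n => (f n).2⟩

/-- Every naive spectrum comes from a levelwise bifibrant spectrum. -/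
lemma exists_bifibrant_naive_iso (X : NaiveSpectrum adj Q) :
    ∃ E : Spectrum T, (∀ n, IsCofibrant (E.obj n)) ∧ (∀ n, IsFibrant (E.obj n)) ∧
      Nonempty ((naive adj Q).obj E ≅ X) := by
  choose Y hY hY' e using fun n => exists_bifibrant_iso (X.obj n)
  replace e (n : ℕ) : (toHo C).obj (Y n) ≅ X.obj n := (e n).some
  have hT (n : ℕ) := isCofibrant_obj adj (Y n)
  have hQ (n : ℕ) := isIso_toHo_map_counit adj Q (Y n)
  choose a ha using fun n => map_surjective_of_isLocalization (toHo C) (T.obj (Y n)) (Y (n + 1))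
    (inv ((toHo C).map (T.map (Q.counit.app (Y n)))) ≫ (leftDerivedIso adj Q).inv.app (Y n) ≫
      (leftDerived adj Q).map (e n).hom ≫ X.assembly n ≫ (e (n + 1)).inv)
  let E : Spectrum T := { obj := Y, assembly := a }
  exact ⟨E, hY, hY', ⟨Spectrum.isoMk e fun n => by simp [naive, E, ha]⟩⟩

/-- A levelwise equivalence induces an isomorphism of naive spectra. -/
lemma isIso_naive_map {A B : Spectrum T} (f : A ⟶ B) (hf : levelEquivalences T f) :
    IsIso ((naive adj Q).map f) := by
  have hf' (n : ℕ) : IsIso ((toHo C).map (f.hom n)) := have := hf n; isIso_toHo_map _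
  exact (Spectrum.isoMk (fun n => @asIso _ _ _ _ _ (hf' n))
    ((naive adj Q).map f).comm).isIso_hom

/-- A spectrum whose naive spectrum agrees with that of a levelwise bifibrant spectrum `E` is
isomorphic to `E` in the levelwise homotopy category. -/
lemma nonempty_toLevelHo_iso {E E' : Spectrum T} (hE : ∀ n, IsCofibrant (E.obj n))
    (hE' : ∀ n, IsFibrant (E.obj n)) (e : (naive adj Q).obj E' ≅ (naive adj Q).obj E) :
    Nonempty ((toLevelHo T).obj E' ≅ (toLevelHo T).obj E) := by
  -- `E` is cofibrant only levelwise, so it serves as target; the source is the resolution of `E'`,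
  -- whose assembly morphisms are cofibrations.
  have hr := levelEquivalences_resolutionHom E'
  have := isIso_naive_map adj Q _ hr
  let φ := asIso ((naive adj Q).map (resolutionHom E')) ≪≫ e
  obtain ⟨f, hf⟩ := exists_naive_map_eq adj Q (isCofibrant_resolution_obj E' adj 0)
    (cofibration_resolution_assembly E') hE' φ.hom
  have hf' : levelEquivalences T f := by
    intro n
    have := isCofibrant_resolution_obj E' adj n
    have : IsIso ((toHo C).map (f.hom n)) := by
      have hn : (toHo C).map (f.hom n) = (Spectrum.levelIso φ n).hom :=
        congrArg (fun g => Spectrum.Hom.hom g n) hf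
      rw [hn]
      exact (Spectrum.levelIso φ n).isIso_hom
    exact weakEquivalence_of_isIso_toHo_map (f.hom n)
  have := Localization.inverts (toLevelHo T) (levelEquivalences T) _ hr
  have := Localization.inverts (toLevelHo T) (levelEquivalences T) _ hf'
  exact ⟨(asIso ((toLevelHo T).map (resolutionHom E'))).symm ≪≫ asIso ((toLevelHo T).map f)⟩

end Lifting

/-! ### Passage to the stable homotopy category -/

section Stable

variable {C : Type u} [Category.{v} C] [ModelCategory C] {T U : C ⥤ C} (adj : T ⊣ U)

/-- Precomposition with an isomorphism of the levelwise homotopy category is bijective. -/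
lemma levelEquivalences_le_stableEquivalences :
    levelEquivalences T ≤ stableEquivalences adj := by
  intro A B f hf W _
  have := Localization.inverts (toLevelHo T) (levelEquivalences T) f hf
  exact ((asIso ((toLevelHo T).map f)).symm.homFromEquiv).bijective

/-- Spectra which are isomorphic in the levelwise homotopy category are isomorphic in the stable
homotopy category. -/
lemma nonempty_toSH_iso {A B : Spectrum T}
    (h : Nonempty ((toLevelHo T).obj A ≅ (toLevelHo T).obj B)) :
    Nonempty ((toSH adj).obj A ≅ (toSH adj).obj B) := by
  have hL : (levelEquivalences T).IsInvertedBy (toSH adj) := fun _ _ f hf =>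
    Localization.inverts (toSH adj) (stableEquivalences adj) f
      (levelEquivalences_le_stableEquivalences adj f hf)
  let e := Localization.fac (toSH adj) hL (toLevelHo T)
  exact h.map fun i => e.symm.app A ≪≫
    (Localization.lift (toSH adj) hL (toLevelHo T)).mapIso i ≪≫ e.app B

end Stable

end NaiveSpectra

open NaiveSpectra in
theorem theoremA {C : Type u} [Category.{v} C] [ModelCategory C] [HasZeroObject C]
    [IsCofibrantlyGenerated C] {T U : C ⥤ C} (adj : T ⊣ U) [IsQuillenAdjunction adj]
    (Q : CofibrantReplacement C) (X : NaiveSpectrum adj Q) :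
    (∃ E : Spectrum T, Nonempty ((naive adj Q).obj E ≅ X) ∧
      ∀ E' : Spectrum T, Nonempty ((naive adj Q).obj E' ≅ X) →
        Nonempty ((toLevelHo T).obj E' ≅ (toLevelHo T).obj E)) ∧
    (∃ Y : SH adj, ∀ Z : SH adj,
      (∃ E : Spectrum T, Nonempty ((naive adj Q).obj E ≅ X) ∧
        Nonempty ((toSH adj).obj E ≅ Z)) ↔ Nonempty (Z ≅ Y)) := by
  obtain ⟨E, hE, hE', ⟨e⟩⟩ := exists_bifibrant_naive_iso adj Q X
  have h (E' : Spectrum T) (h' : Nonempty ((naive adj Q).obj E' ≅ X)) :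
      Nonempty ((toLevelHo T).obj E' ≅ (toLevelHo T).obj E) :=
    nonempty_toLevelHo_iso adj Q hE hE' (h'.some ≪≫ e.symm)
  refine ⟨⟨E, ⟨e⟩, h⟩, (toSH adj).obj E, fun Z => ⟨?_, fun ⟨i⟩ => ⟨E, ⟨e⟩, ⟨i.symm⟩⟩⟩⟩
  rintro ⟨E', h', ⟨i⟩⟩
  obtain ⟨j⟩ := nonempty_toSH_iso adj (h E' h')
  exact ⟨i.symm ≪≫ j⟩
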